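/- A compact set $E\subset\mathbb R$ with at least two points is called $s$-regular ($s>0$) with Ahlfors constant $C>0$ if there is a Borel measure $\mu$ on $\mathbb R$ with $\mu(\mathbb R\setminus E)=0$ and $$\tfrac1C\,r^s\le\mu(B(x,r))\le C\,r^s\qquad\text{for all }x\in E\text{ and }0<r\le\operatorname{diam}E .$$ For a real number $p>2$, the standard Cantor set $C_p\subset[0,1]$ is $\bigcap_n A_n$, where $A_0=[0,1]$ and $A_{n+1}$ arises from $A_n$ by removing from each of its component intervals $I$ the open central subinterval of length $\frac{p-2}{p}|I|$ (so that two intervals of length $|I|/p$ remain). **Theorem.** Let $s<t$. For all real numbers $d_E,d_F,c_E,c_F$ there is a constant $L$, depending only on $s,t,d_E,d_F,c_E,c_F$, with the following property. Let $E\subset\mathbb R$ be an $s$-regular set with Ahlfors constant $c_E$ and diameter $d_E$, and let $F\subset\mathbb R$ be a $t$-regular set with Ahlfors constant $c_F$ and diameter $d_F$, both with the order of the line, and suppose that at least one of $E$ and $F$ is a standard Cantor set $C_p$ for some $p>2$. Then there is a strictly increasing map $\varphi:E\to F$ with $$\tfrac1L|x-y|\le|\varphi(x)-\varphi(y)|\le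 L|x-y|\qquad\text{for all }x,y\in E .$$ -/

import Mathlib

open scoped NNReal ENNReal

/-- The `n`-th stage of the construction of the standard Cantor set with parameter `p`: start
from `[0, 1]` and, at every step, cut every remaining interval `I` into three pieces of lengths
`|I| / p`, `(p - 2) |I| / p`, `|I| / p` and remove the (open) central one. Since all the intervals
of a stage are affine images of `[0, 1]`, the stage `n + 1` consists of two copies of the stage `n`
scaled by `1 / p`, placed at the left and at the right end of `[0, 1]`.
(For `p = 3` this is Mathlib's `preCantorSet`.) -/
noncomputable def cantorStage (p : ℝ) : ℕ → Set ℝ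
  | 0 => Set.Icc 0 1
  | n + 1 => (fun x => x / p) '' cantorStage p n ∪ (fun x => (p - 1 + x) / p) '' cantorStage p n

/-- The standard Cantor set with parameter `p` (of interest for `p > 2`; its dimension is then
`log 2 / log p`). -/
noncomputable def standardCantor (p : ℝ) : Set ℝ := ⋂ n, cantorStage p n

/-- `E` is one of the standard Cantor sets. -/
def IsStandardCantor (E : Set ℝ) : Prop := ∃ p : ℝ, 2 < p ∧ E = standardCantor p

/-- `E` is a (compact, non-degenerate) Ahlfors `s`-regular subset of the line with constant `C`:
it carries a Borel measure `μ` such that `C⁻¹ r ^ s ≤ μ (B(x, r)) ≤ C r ^ s` for all `x ∈ E` and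
`0 < r ≤ diam E`. -/
structure IsAhlforsRegularSet (s C : ℝ) (E : Set ℝ) : Prop where
  dim_pos : 0 < s
  const_pos : 0 < C
  isClosed : IsClosed E
  isBounded : Bornology.IsBounded E
  nontrivial : E.Nontrivial
  exists_measure : ∃ μ : MeasureTheory.Measure ℝ, μ Eᶜ = 0 ∧
    ∀ x ∈ E, ∀ r : ℝ, 0 < r → r ≤ Metric.diam E →
      ENNReal.ofReal (C⁻¹ * r ^ s) ≤ μ (Metric.ball x r) ∧
        μ (Metric.ball x r) ≤ ENNReal.ofReal (C * r ^ s)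

/-!
Both sets are compared with a space of sequences of digits below a number `M`, ordered
lexicographically, in which two sequences that first differ at place `l` are at distance about
`q ^ (-l)`. All comparisons rest on counting separated points with the mass bounds.

On the side of `E`, the dimension satisfies `s < t ≤ 1`
(`IsAhlforsRegularSet.dim_le_one`), so `E` is uniformly disconnected: a stretch of `E` without gaps
of length `δ` has length at most `A * δ` (`IsAhlforsRegularSet.sub_le_of_not_hasGap`). Cutting `E` at
all gaps of length at least `δ_k`, a constant times `q ^ (-k)`, gives for increasing `k` nested
partitions into classes of diameter about `δ_k` that are `δ_k` apart. By counting masses of disjoint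
balls, each class splits into at most a constant times `q ^ s` classes of the next level. The ranks
of the successive classes of a point are its digits, and this coding preserves the order and records
distances up to constants (`IsAhlforsRegularSet.exists_coding`).

On the side of `F`, every ball of radius `r` around a point of `F` contains, again by counting
masses, at least a constant times `q ^ t` points of `F` that are `4 * r / q` apart
(`IsAhlforsRegularSet.exists_separated`). Iterating this gives a tree of points whose branches
converge in `F`, so that digit sequences are mapped to `F` increasingly and with the same control of
distances (`IsAhlforsRegularSet.exists_tree`).

Since `s < t`, for large `q` one `M` serves both sides (`exists_le_mul_rpow`), and the composition
is the embedding.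
-/

open MeasureTheory Metric Filter Topology

/-! ### Counting separated points in regular sets -/

theorem IsAhlforsRegularSet.diam_pos {s C : ℝ} {E : Set ℝ} (h : IsAhlforsRegularSet s C E) :
    0 < diam E := by
  obtain ⟨x, hx, y, hy, hxy⟩ := h.nontrivial
  exact (dist_pos.2 hxy).trans_le (dist_le_diam_of_mem h.isBounded hx hy)

/-- The upper mass bound extends to all radii, at the price of a factor `2`: the open balls of
radius `diam E` around the two extreme points cover `E`. -/
theorem IsAhlforsRegularSet.exists_measure_forall_radius {s C : ℝ} {E : Set ℝ}
    (h : IsAhlforsRegularSet s C E) :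
    ∃ μ : Measure ℝ, ∀ x ∈ E, ∀ r : ℝ, 0 < r →
      (r ≤ diam E → ENNReal.ofReal (C⁻¹ * r ^ s) ≤ μ (ball x r)) ∧
        μ (ball x r) ≤ ENNReal.ofReal (2 * C * r ^ s) := by
  obtain ⟨μ, hμ, hb⟩ := h.exists_measure
  have hd := h.diam_pos
  have hC := h.const_pos
  have hs := h.dim_pos
  refine ⟨μ, fun x hx r hr => ⟨fun hrd => (hb x hx r hr hrd).1, ?_⟩⟩
  rcases le_or_gt r (diam E) with hrd | hrd
  · refine (hb x hx r hr hrd).2.trans (ENNReal.ofReal_le_ofReal ?_)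
    have := Real.rpow_nonneg hr.le s
    nlinarith [mul_nonneg hC.le this]
  have hcpt : IsCompact E := Metric.isCompact_of_isClosed_isBounded h.isClosed h.isBounded
  obtain ⟨a, haE, ha⟩ := hcpt.exists_isLeast h.nontrivial.nonempty
  obtain ⟨b, hbE, hb'⟩ := hcpt.exists_isGreatest h.nontrivial.nonempty
  have hab : b - a ≤ diam E := by
    have := dist_le_diam_of_mem h.isBounded hbE haE
    rw [Real.dist_eq] at this
    exact (le_abs_self _).trans this
  have hcov : ball x r ⊆ Eᶜ ∪ (ball a (diam E) ∪ ball b (diam E)) := by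
    intro z _
    by_cases hz : z ∈ E
    · right
      rcases (hb' hz).lt_or_eq with h1 | h1
      · left
        rw [mem_ball, Real.dist_eq, abs_of_nonneg (sub_nonneg.2 (ha hz))]
        linarith
      · right
        rw [h1]
        exact mem_ball_self hd
    · exact Or.inl hz
  have hds : diam E ^ s ≤ r ^ s := Real.rpow_le_rpow hd.le hrd.le hs.le
  have hds0 : 0 ≤ diam E ^ s := Real.rpow_nonneg hd.le s
  calc μ (ball x r) ≤ μ (Eᶜ ∪ (ball a (diam E) ∪ ball b (diam E))) := measure_mono hcov
    _ ≤ μ Eᶜ + (μ (ball a (diam E)) + μ (ball b (diam E))) :=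
        (measure_union_le _ _).trans (by gcongr; exact measure_union_le _ _)
    _ ≤ 0 + (ENNReal.ofReal (C * diam E ^ s) + ENNReal.ofReal (C * diam E ^ s)) := by
        gcongr
        · exact hμ.le
        · exact (hb a haE _ hd le_rfl).2
        · exact (hb b hbE _ hd le_rfl).2
    _ = ENNReal.ofReal (2 * C * diam E ^ s) := by
        rw [zero_add, ← ENNReal.ofReal_add (by positivity) (by positivity)]
        congr 1
        ring
    _ ≤ ENNReal.ofReal (2 * C * r ^ s) := by
        apply ENNReal.ofReal_le_ofReal
        gcongr

/-- A regular set of dimension `s` contains at most a constant times `(R / r) ^ s` points that are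
pairwise `r` apart and at distance at most `R` from a given point. -/
theorem IsAhlforsRegularSet.card_le_of_separated {s C : ℝ} {E : Set ℝ}
    (h : IsAhlforsRegularSet s C E) {x₀ r R : ℝ} (hx₀ : x₀ ∈ E) (hr : 0 < r) (hrE : r ≤ diam E)
    (hrR : r ≤ R) {T : Finset ℝ} (hTE : ∀ z ∈ T, z ∈ E) (hTR : ∀ z ∈ T, |z - x₀| ≤ R)
    (hT : ∀ z ∈ T, ∀ w ∈ T, z ≠ w → r ≤ |z - w|) :
    (T.card : ℝ) ≤ 2 * C ^ 2 * 4 ^ s * (R / r) ^ s := by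
  obtain ⟨μ, hμ⟩ := h.exists_measure_forall_radius
  have hC := h.const_pos
  have hR : 0 < R := hr.trans_le hrR
  have hdisj : (T : Set ℝ).PairwiseDisjoint (fun z => ball z (r / 2)) := by
    intro z hz w hw hzw
    refine ball_disjoint_ball ?_
    rw [Real.dist_eq]
    linarith [hT z hz w hw hzw]
  have hsub : (⋃ z ∈ T, ball z (r / 2)) ⊆ ball x₀ (2 * R) := by
    refine Set.iUnion₂_subset fun z hz => ball_subset_ball' ?_
    rw [Real.dist_eq]
    linarith [hTR z hz]
  have key : (T.card : ENNReal) * ENNReal.ofReal (C⁻¹ * (r / 2) ^ s)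
      ≤ ENNReal.ofReal (2 * C * (2 * R) ^ s) := by
    calc (T.card : ENNReal) * ENNReal.ofReal (C⁻¹ * (r / 2) ^ s)
        = ∑ z ∈ T, ENNReal.ofReal (C⁻¹ * (r / 2) ^ s) := by simp
      _ ≤ ∑ z ∈ T, μ (ball z (r / 2)) :=
          Finset.sum_le_sum fun z hz => (hμ z (hTE z hz) _ (by positivity)).1 (by linarith)
      _ = μ (⋃ z ∈ T, ball z (r / 2)) :=
          (measure_biUnion_finset hdisj fun z _ => measurableSet_ball).symm
      _ ≤ μ (ball x₀ (2 * R)) := measure_mono hsub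
      _ ≤ _ := (hμ x₀ hx₀ _ (by positivity)).2
  rw [← ENNReal.ofReal_natCast, ← ENNReal.ofReal_mul (by positivity),
    ENNReal.ofReal_le_ofReal_iff (by positivity)] at key
  have e1 : (2 * R) ^ s = 4 ^ s * (R / r) ^ s * (r / 2) ^ s := by
    rw [← Real.mul_rpow (by positivity) (by positivity),
      ← Real.mul_rpow (by positivity) (by positivity)]
    congr 1
    field_simp
    norm_num
  rw [e1] at key
  have hp : 0 < (r / 2) ^ s := by positivity
  have key2 : (T.card : ℝ) * C⁻¹ ≤ 2 * C * (4 ^ s * (R / r) ^ s) := by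
    refine le_of_mul_le_mul_right ?_ hp
    linarith
  calc (T.card : ℝ) = T.card * C⁻¹ * C := by field_simp
    _ ≤ 2 * C * (4 ^ s * (R / r) ^ s) * C := by gcongr
    _ = _ := by ring

/-- A regular set of dimension `t` has, in every ball around one of its points, `M` points that are
pairwise `4 / q` times the radius apart, for any `M` up to a constant times `q ^ t`. They are
listed here in increasing order. -/
theorem IsAhlforsRegularSet.exists_separated {t C : ℝ} {F : Set ℝ}
    (h : IsAhlforsRegularSet t C F) {q : ℝ} (hq : 4 ≤ q) {M : ℕ}
    (hM : (M : ℝ) ≤ (C ^ 2)⁻¹ * (q / 4) ^ t) {x r : ℝ} (hx : x ∈ F) (hr : 0 < r)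
    (hrF : r ≤ diam F) :
    ∃ y : ℕ → ℝ, (∀ i < M, y i ∈ F ∧ |y i - x| ≤ r) ∧
      ∀ i j, i < j → j < M → 4 * (r / q) ≤ y j - y i := by
  obtain ⟨μ, hμ, hb⟩ := h.exists_measure
  have hC := h.const_pos
  have hq0 : 0 < q := by linarith
  set σ : ℝ := 4 * (r / q) with hσ
  have hσ0 : 0 < σ := by positivity
  have hσr : σ ≤ r := by
    rw [hσ, ← mul_div_assoc, div_le_iff₀ hq0]
    nlinarith
  have hrσ : r ^ t = (q / 4) ^ t * σ ^ t := by
    rw [← Real.mul_rpow (by positivity) hσ0.le]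
    congr 1
    rw [hσ]
    field_simp
  -- As long as fewer than `M` points are chosen, the `σ`-balls around them have too little mass
  -- to cover `F ∩ ball x r`.
  have hex : ∀ m ≤ M, ∃ T : Finset ℝ, T.card = m ∧ (∀ z ∈ T, z ∈ F ∧ |z - x| ≤ r) ∧
      ∀ z ∈ T, ∀ w ∈ T, z ≠ w → σ ≤ |z - w| := by
    intro m
    induction m with
    | zero => exact fun _ => ⟨∅, by simp⟩
    | succ m ih =>
      intro hm
      obtain ⟨T, hTc, hTF, hTs⟩ := ih (by omega)
      have hnot : ¬ ball x r ⊆ Fᶜ ∪ ⋃ z ∈ T, ball z σ := by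
        intro hsub
        have key : ENNReal.ofReal (C⁻¹ * r ^ t) ≤ ENNReal.ofReal (m * (C * σ ^ t)) := by
          calc ENNReal.ofReal (C⁻¹ * r ^ t) ≤ μ (ball x r) := (hb x hx r hr hrF).1
            _ ≤ μ (Fᶜ ∪ ⋃ z ∈ T, ball z σ) := measure_mono hsub
            _ ≤ μ Fᶜ + μ (⋃ z ∈ T, ball z σ) := measure_union_le _ _
            _ = μ (⋃ z ∈ T, ball z σ) := by rw [hμ, zero_add]
            _ ≤ ∑ z ∈ T, μ (ball z σ) := measure_biUnion_finset_le _ _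
            _ ≤ ∑ z ∈ T, ENNReal.ofReal (C * σ ^ t) :=
                Finset.sum_le_sum fun z hz => (hb z (hTF z hz).1 σ hσ0 (hσr.trans hrF)).2
            _ = ENNReal.ofReal (m * (C * σ ^ t)) := by
                rw [ENNReal.ofReal_mul (Nat.cast_nonneg m), ENNReal.ofReal_natCast]
                simp [hTc]
        rw [ENNReal.ofReal_le_ofReal_iff (by positivity), hrσ] at key
        have hp : 0 < σ ^ t := by positivity
        have key2 : C⁻¹ * (q / 4) ^ t ≤ m * C := by
          refine le_of_mul_le_mul_right ?_ hp
          linarith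
        have key3 : (C ^ 2)⁻¹ * (q / 4) ^ t ≤ m := by
          calc (C ^ 2)⁻¹ * (q / 4) ^ t = C⁻¹ * (C⁻¹ * (q / 4) ^ t) := by
                rw [pow_two, mul_inv]; ring
            _ ≤ C⁻¹ * (m * C) := by gcongr
            _ = m := by field_simp
        have : ((m + 1 : ℕ) : ℝ) ≤ m := (Nat.cast_le.2 hm).trans (hM.trans key3)
        push_cast at this
        linarith
      obtain ⟨y, hyr, hy⟩ := Set.not_subset.1 hnot
      simp only [Set.mem_union, Set.mem_compl_iff, Set.mem_iUnion, mem_ball, Real.dist_eq,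
        exists_prop, not_or, not_not, not_exists, not_and, not_lt] at hy
      rw [mem_ball, Real.dist_eq] at hyr
      have hyT : y ∉ T := by
        intro hyT
        have := hy.2 y hyT
        simp at this
        linarith
      refine ⟨insert y T, by rw [Finset.card_insert_of_notMem hyT, hTc], ?_, ?_⟩
      · intro z hz
        rcases Finset.mem_insert.1 hz with rfl | hz
        · exact ⟨hy.1, hyr.le⟩
        · exact hTF z hz
      · intro z hz w hw hzw
        rcases Finset.mem_insert.1 hz with rfl | hz' <;>
          rcases Finset.mem_insert.1 hw with rfl | hw'
        · exact absurd rfl hzw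
        · exact hy.2 w hw'
        · rw [abs_sub_comm]
          exact hy.2 z hz'
        · exact hTs z hz' w hw' hzw
  obtain ⟨T, hTc, hTF, hTs⟩ := hex M le_rfl
  have hval : ∀ i (hi : i < M), T.orderEmbOfFin hTc ⟨i, hi⟩ ∈ T := fun i hi =>
    T.orderEmbOfFin_mem hTc _
  refine ⟨fun i => if hi : i < M then T.orderEmbOfFin hTc ⟨i, hi⟩ else 0, ?_, ?_⟩
  · intro i hi
    simp only [dif_pos hi]
    exact hTF _ (hval i hi)
  · intro i j hij hj
    have hi := hij.trans hj
    simp only [dif_pos hi, dif_pos hj]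
    have hlt : T.orderEmbOfFin hTc ⟨i, hi⟩ < T.orderEmbOfFin hTc ⟨j, hj⟩ :=
      (T.orderEmbOfFin hTc).strictMono hij
    have := hTs _ (hval j hj) _ (hval i hi) hlt.ne'
    rwa [abs_of_pos (sub_pos.2 hlt)] at this

/-- A higher power eventually beats a lower one. -/
theorem exists_le_mul_rpow {s t : ℝ} (hs : 0 ≤ s) (hst : s < t) (a b : ℝ) {c : ℝ}
    (hb : 0 ≤ b) (hc : 0 < c) : ∃ q : ℝ, 4 ≤ q ∧ a * q ^ s + b ≤ c * q ^ t := by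
  obtain ⟨q, hq1, hq⟩ := ((tendsto_rpow_atTop (sub_pos.2 hst)).eventually_ge_atTop
    ((a + b) / c) |>.and (eventually_ge_atTop 4)).exists
  refine ⟨q, hq, ?_⟩
  have hq0 : 0 < q := by linarith
  have h1 : 1 ≤ q ^ s := Real.one_le_rpow (by linarith) hs
  rw [div_le_iff₀ hc] at hq1
  calc a * q ^ s + b ≤ (a + b) * q ^ s := by nlinarith
    _ ≤ (q ^ (t - s) * c) * q ^ s := by gcongr
    _ = c * (q ^ (t - s) * q ^ s) := by ring
    _ = c * q ^ t := by rw [← Real.rpow_add hq0, sub_add_cancel]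

/-- In dimension `t > 1` there would be at least `q + 1` points of `F` in an interval of length
`2 * diam F` at mutual distance `4 * diam F / q`. -/
theorem IsAhlforsRegularSet.dim_le_one {t C : ℝ} {F : Set ℝ} (h : IsAhlforsRegularSet t C F) :
    t ≤ 1 := by
  by_contra! ht
  have hC := h.const_pos
  obtain ⟨q, hq, hle⟩ := exists_le_mul_rpow zero_le_one ht 1 2 (c := (C ^ 2)⁻¹ * (1 / 4) ^ t)
    (by norm_num) (by positivity)
  have hq0 : 0 < q := by linarith
  obtain ⟨x, hx⟩ := h.nontrivial.nonempty
  have hd := h.diam_pos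
  set n := ⌈q⌉₊ with hn
  have hn1 : (n : ℝ) < q + 1 := Nat.ceil_lt_add_one hq0.le
  have hn2 : q ≤ n := Nat.le_ceil q
  have hM : ((n + 1 : ℕ) : ℝ) ≤ (C ^ 2)⁻¹ * (q / 4) ^ t := by
    have : (q / 4) ^ t = (1 / 4) ^ t * q ^ t := by
      rw [← Real.mul_rpow (by positivity) hq0.le]
      congr 1
      ring
    rw [this, ← mul_assoc]
    rw [Real.rpow_one] at hle
    push_cast
    linarith
  obtain ⟨y, hy1, hy2⟩ := h.exists_separated hq hM hx hd le_rfl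
  -- The `n + 1` points are too many for an interval of length `2 * diam F`.
  have hmul : ∀ i, i < n + 1 → i * (4 * (diam F / q)) ≤ y i - y 0 := by
    intro i
    induction i with
    | zero => simp
    | succ i ih =>
      intro hi
      have h1 := ih (by omega)
      have h2 := hy2 i (i + 1) (by omega) hi
      push_cast
      linarith
  have h1 := hmul n (by omega)
  have h2 := abs_le.1 (hy1 n (by omega)).2
  have h3 := abs_le.1 (hy1 0 (by omega)).2
  have h4 : q * (4 * (diam F / q)) ≤ n * (4 * (diam F / q)) := by gcongr
  have h5 : q * (4 * (diam F / q)) = 4 * diam F := by field_simp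
  linarith

/-! ### Gaps and the coding of a regular set -/

/-- `HasGap E δ x y`: the interval `[x, y]` contains an open interval of length `δ` that does not
meet `E`. For points of `E`, being joined by an interval without such a gap is an equivalence
relation when `0 < δ`. Its classes at gap size `δ`, ordered along the line, play the role of the
intervals in one stage of the construction of a Cantor set. -/
def HasGap (E : Set ℝ) (δ x y : ℝ) : Prop :=
  ∃ a, x ≤ a ∧ a + δ ≤ y ∧ ∀ z ∈ E, a < z → a + δ ≤ z

section Gap

variable {E : Set ℝ} {δ δ' x y z : ℝ}

theorem HasGap.le_sub (h : HasGap E δ x y) : δ ≤ y - x := by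
  obtain ⟨a, h1, h2, -⟩ := h
  linarith

theorem HasGap.mono {x' y' : ℝ} (h : HasGap E δ x y) (hx : x' ≤ x) (hy : y ≤ y') :
    HasGap E δ x' y' := by
  obtain ⟨a, h1, h2, h3⟩ := h
  exact ⟨a, hx.trans h1, h2.trans hy, h3⟩

theorem HasGap.of_le (h : HasGap E δ x y) (hδ : δ' ≤ δ) : HasGap E δ' x y := by
  obtain ⟨a, h1, h2, h3⟩ := h
  exact ⟨a, h1, by linarith, fun z hz haz => by linarith [h3 z hz haz]⟩

/-- A point of `E` lies on one side of every gap. -/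
theorem HasGap.left_or_right (h : HasGap E δ x z) (hy : y ∈ E) :
    HasGap E δ x y ∨ HasGap E δ y z := by
  obtain ⟨a, h1, h2, h3⟩ := h
  rcases le_or_gt y a with h4 | h4
  · exact Or.inr ⟨a, h4, h2, h3⟩
  · exact Or.inl ⟨a, h1, h3 y hy h4, h3⟩

end Gap

/-- Uniform disconnectedness of regular sets of dimension less than `1`: the constant `A` bounds
the length of a gap-free stretch in terms of the size of the excluded gaps. If `[x, y]` has no gap
of length `δ`, then `E` has about `(y - x) / (2 * δ)` points there that are `δ` apart, more than
the dimension allows. -/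
theorem IsAhlforsRegularSet.sub_le_of_not_hasGap {s C : ℝ} {E : Set ℝ}
    (h : IsAhlforsRegularSet s C E) (hs1 : s < 1) {δ x y : ℝ} (hδ : 0 < δ) (hx : x ∈ E)
    (hy : y ∈ E) (hgap : ¬ HasGap E δ x y) :
    y - x ≤ max 2 ((4 * (2 * C ^ 2 * 4 ^ s)) ^ (1 / (1 - s))) * δ := by
  rcases le_or_gt (y - x) (2 * δ) with h2 | h2
  · exact h2.trans (by gcongr; exact le_max_left _ _)
  set K : ℝ := 2 * C ^ 2 * 4 ^ s with hK
  set D : ℝ := (y - x) / δ with hD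
  have hyx : y - x = D * δ := by rw [hD]; field_simp
  have hD2 : 2 < D := by rwa [hD, lt_div_iff₀ hδ]
  set n := ⌊D / 2⌋₊ with hn
  have hn1 : (n : ℝ) ≤ D / 2 := Nat.floor_le (by linarith)
  have hn2 : D / 2 < n + 1 := Nat.lt_floor_add_one _
  have hn3 : 1 ≤ n := Nat.le_floor (by push_cast; linarith)
  have hn4 : D / 4 ≤ n := by
    have : (1 : ℝ) ≤ n := by exact_mod_cast hn3
    linarith
  have hpt : ∀ j : ℕ, ∃ z, j < n → z ∈ E ∧ x + 2 * j * δ < z ∧ z < x + 2 * j * δ + δ := by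
    intro j
    by_contra! hcon
    have hj := (hcon 0).1
    refine hgap ⟨x + 2 * j * δ, by linarith [show 0 ≤ 2 * j * δ by positivity], ?_, ?_⟩
    · have : (j : ℝ) + 1 ≤ n := by exact_mod_cast hj
      nlinarith
    · exact fun z hz hlt => (hcon z).2 hz hlt
  choose z hz using hpt
  have hsep : ∀ i j, i < j → j < n → δ ≤ z j - z i := by
    intro i j hij hj
    have h1 := (hz i (hij.trans hj)).2.2
    have h2 := (hz j hj).2.1
    have : (i : ℝ) + 1 ≤ j := by exact_mod_cast hij
    nlinarith
  have hinj : Set.InjOn z (Finset.range n) := by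
    intro i hi j hj hij
    simp only [Finset.coe_range, Set.mem_Iio] at hi hj
    rcases lt_trichotomy i j with h' | h' | h'
    · linarith [hsep i j h' hj]
    · exact h'
    · linarith [hsep j i h' hi]
  have hdE : y - x ≤ diam E := by
    have := dist_le_diam_of_mem h.isBounded hy hx
    rw [Real.dist_eq] at this
    exact (le_abs_self _).trans this
  have hcard := h.card_le_of_separated (R := y - x) (r := δ) hx hδ (by linarith) (by linarith)
    (T := (Finset.range n).image z) ?_ ?_ ?_
  · rw [Finset.card_image_of_injOn hinj, Finset.card_range, ← hK, ← hD] at hcard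
    have hD0 : 0 < D := by linarith
    have h1 : D ≤ 4 * K * D ^ s := by linarith
    have h3 : D ^ (1 - s) ≤ 4 * K := by
      rw [Real.rpow_sub hD0, Real.rpow_one, div_le_iff₀ (by positivity)]
      exact h1
    have h4 : D ≤ (4 * K) ^ (1 / (1 - s)) := by
      have := Real.rpow_le_rpow (by positivity) h3 (show 0 ≤ 1 / (1 - s) from
        div_nonneg zero_le_one (by linarith))
      rwa [← Real.rpow_mul hD0.le, mul_one_div_cancel (by linarith), Real.rpow_one] at this
    rw [hyx]
    gcongr
    exact h4.trans (le_max_right _ _)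
  · intro w hw
    obtain ⟨i, hi, rfl⟩ := Finset.mem_image.1 hw
    exact (hz i (Finset.mem_range.1 hi)).1
  · intro w hw
    obtain ⟨i, hi, rfl⟩ := Finset.mem_image.1 hw
    have hi := Finset.mem_range.1 hi
    obtain ⟨-, h1, h2⟩ := hz i hi
    have : (i : ℝ) + 1 ≤ n := by exact_mod_cast hi
    have h3 : 0 ≤ 2 * (i : ℝ) * δ := by positivity
    rw [abs_of_nonneg (by linarith)]
    nlinarith
  · intro v hv w hw hvw
    obtain ⟨i, hi, rfl⟩ := Finset.mem_image.1 hv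
    obtain ⟨j, hj, rfl⟩ := Finset.mem_image.1 hw
    have hi := Finset.mem_range.1 hi
    have hj := Finset.mem_range.1 hj
    rcases lt_trichotomy i j with h' | h' | h'
    · rw [abs_sub_comm]
      exact (hsep i j h' hj).trans (le_abs_self _)
    · exact absurd (by rw [h']) hvw
    · exact (hsep j i h' hi).trans (le_abs_self _)

/-- `GapChain E δ δ' m x`: inside its class at gap size `δ`, the point `x` has at least `m` classes
at gap size `δ'` to its left. -/
def GapChain (E : Set ℝ) (δ δ' : ℝ) : ℕ → ℝ → Prop
  | 0, _ => True
  | m + 1, x => ∃ z ∈ E, ¬ HasGap E δ z x ∧ HasGap E δ' z x ∧ GapChain E δ δ' m z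

/-- The number of classes to the left of a point depends only on the class of the point. -/
theorem gapChain_iff_of_not_hasGap {E : Set ℝ} {δ δ' x y : ℝ} (hδ : δ' ≤ δ) (hx : x ∈ E)
    (hxy : x ≤ y) (h : ¬ HasGap E δ' x y) (m : ℕ) :
    GapChain E δ δ' m x ↔ GapChain E δ δ' m y := by
  cases m with
  | zero => rfl
  | succ m =>
    constructor
    · rintro ⟨z, hz, h1, h2, h3⟩
      refine ⟨z, hz, fun h4 => ?_, h2.mono le_rfl hxy, h3⟩
      rcases h4.left_or_right hx with h5 | h5
      · exact h1 h5
      · exact h (h5.of_le hδ)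
    · rintro ⟨z, hz, h1, h2, h3⟩
      refine ⟨z, hz, fun h4 => h1 (h4.mono le_rfl hxy), ?_, h3⟩
      exact (h2.left_or_right hx).resolve_right h

/-- One point from each class of a chain: these points are `δ'` apart, so that their number can be
bounded by `IsAhlforsRegularSet.card_le_of_separated`. -/
theorem GapChain.exists_finset {E : Set ℝ} {δ δ' : ℝ} (hδ' : 0 < δ') :
    ∀ {m : ℕ} {x : ℝ}, x ∈ E → 0 < δ → GapChain E δ δ' m x →
      ∃ T : Finset ℝ, T.card = m + 1 ∧
        (∀ z ∈ T, z ∈ E ∧ z ≤ x ∧ ¬ HasGap E δ z x) ∧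
        ∀ z ∈ T, ∀ w ∈ T, z ≠ w → δ' ≤ |z - w| := by
  intro m
  induction m with
  | zero =>
    intro x hx hδ _
    refine ⟨{x}, by simp, ?_, ?_⟩
    · intro z hz
      rw [Finset.mem_singleton] at hz
      subst hz
      exact ⟨hx, le_rfl, fun h => by linarith [h.le_sub]⟩
    · intro z hz w hw hzw
      rw [Finset.mem_singleton] at hz hw
      exact absurd (hz.trans hw.symm) hzw
  | succ m ih =>
    rintro x hx hδ ⟨z, hz, h1, h2, h3⟩
    obtain ⟨T, hTc, hTE, hTs⟩ := ih hz hδ h3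
    have hzx := h2.le_sub
    have hsep : ∀ w ∈ T, δ' ≤ x - w := fun w hw => by linarith [(hTE w hw).2.1]
    have hxT : x ∉ T := fun hxT => by linarith [hsep x hxT]
    refine ⟨insert x T, by rw [Finset.card_insert_of_notMem hxT, hTc], ?_, ?_⟩
    · intro w hw
      rcases Finset.mem_insert.1 hw with rfl | hw
      · exact ⟨hx, le_rfl, fun h => by linarith [h.le_sub]⟩
      · obtain ⟨hwE, hwz, hgap⟩ := hTE w hw
        exact ⟨hwE, by linarith, fun h => (h.left_or_right hz).elim hgap h1⟩
    · intro v hv w hw hvw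
      rcases Finset.mem_insert.1 hv with rfl | hv' <;>
        rcases Finset.mem_insert.1 hw with rfl | hw'
      · exact absurd rfl hvw
      · exact (hsep w hw').trans (le_abs_self _)
      · rw [abs_sub_comm]
        exact (hsep v hv').trans (le_abs_self _)
      · exact hTs v hv' w hw' hvw

/-- Coding of a regular set of dimension less than `1` by sequences with entries below `M`, where
`M` is of the order `q ^ s`: the code is increasing for the lexicographic order, and the first place
`l` where two codes differ determines the distance of the points up to constants, as being
comparable with `q ^ (-l)`. -/
theorem IsAhlforsRegularSet.exists_coding {s C : ℝ} {E : Set ℝ} (h : IsAhlforsRegularSet s C E)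
    {A : ℝ} (hA : 1 ≤ A)
    (hgap : ∀ δ > 0, ∀ x ∈ E, ∀ y ∈ E, ¬ HasGap E δ x y → y - x ≤ A * δ)
    {q : ℝ} (hq : 4 ≤ q) {M : ℕ} (hM : 2 * C ^ 2 * 4 ^ s * (A * q) ^ s ≤ M) :
    ∃ n : ℝ → ℕ → ℕ, (∀ x ∈ E, ∀ k, n x k < M) ∧
      ∀ x ∈ E, ∀ y ∈ E, x < y → ∃ l, (∀ j < l, n x j = n y j) ∧ n x l < n y l ∧
        2 * diam E / q ^ (l + 1) ≤ y - x ∧ y - x ≤ A * (2 * diam E / q ^ l) := by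
  classical
  have hd := h.diam_pos
  have hq0 : 0 < q := by linarith
  set δ : ℕ → ℝ := fun k => 2 * diam E / q ^ k with hδdef
  have hδ0 : ∀ k, 0 < δ k := fun k => by simp only [hδdef]; positivity
  have hδq : ∀ k, δ k = q * δ (k + 1) := fun k => by
    simp only [hδdef, pow_succ]
    field_simp
  have hδs : ∀ k, δ (k + 1) ≤ δ k := fun k => by
    rw [hδq k]
    nlinarith [hδ0 (k + 1)]
  have hδd : ∀ k, δ (k + 1) ≤ diam E := by
    intro k
    simp only [hδdef]
    rw [div_le_iff₀ (by positivity)]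
    have : 1 ≤ q ^ k := one_le_pow₀ (by linarith)
    rw [pow_succ]
    nlinarith [mul_le_mul this hq (by norm_num) (by positivity)]
  have hbound : ∀ x ∈ E, ∀ k m, GapChain E (δ k) (δ (k + 1)) m x → m < M := by
    intro x hx k m hm
    obtain ⟨T, hTc, hTE, hTs⟩ := hm.exists_finset (hδ0 (k + 1)) hx (hδ0 k)
    have hcard := h.card_le_of_separated (R := A * δ k) hx (hδ0 (k + 1)) (hδd k)
      (by nlinarith [hδs k, hδ0 k]) (fun z hz => (hTE z hz).1) (fun z hz => ?_) hTs
    · rw [hTc, hδq k, ← mul_assoc, mul_div_cancel_right₀ _ (hδ0 (k + 1)).ne'] at hcard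
      exact_mod_cast hcard.trans hM
    · obtain ⟨hzE, hzx, hz⟩ := hTE z hz
      rw [abs_sub_comm, abs_of_nonneg (by linarith)]
      exact hgap _ (hδ0 k) z hzE x hx hz
  -- The digit of `x` at level `k` is the rank of its class at gap size `δ (k + 1)` among those
  -- inside its class at gap size `δ k`.
  refine ⟨fun x k => Nat.findGreatest (fun m => GapChain E (δ k) (δ (k + 1)) m x) M, ?_, ?_⟩
  · intro x hx k
    exact hbound x hx k _ (Nat.findGreatest_spec (P := fun m => GapChain E (δ k) (δ (k + 1)) m x)
      (Nat.zero_le M) trivial)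
  · intro x hx y hy hxy
    have hex : ∃ k, HasGap E (δ k) x y := by
      by_contra! hcon
      have hlim : Tendsto (fun k => A * δ k) atTop (𝓝 0) := by
        have h1 : Tendsto (fun k : ℕ => (q⁻¹) ^ k) atTop (𝓝 0) :=
          tendsto_pow_atTop_nhds_zero_of_lt_one (by positivity)
            (inv_lt_one_of_one_lt₀ (by linarith))
        have h2 := h1.const_mul (A * (2 * diam E))
        rw [mul_zero] at h2
        refine h2.congr fun k => ?_
        simp only [hδdef, inv_pow]
        ring
      have := ge_of_tendsto' hlim fun k => hgap _ (hδ0 k) x hx y hy (hcon k)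
      linarith
    have hk := Nat.find_spec hex
    have hmin := fun j => Nat.find_min (H := hex) (m := j)
    generalize Nat.find hex = k at hk hmin
    cases k with
    | zero =>
      -- `E` is a single class at gap size `δ 0 = 2 * diam E`.
      exfalso
      have h1 := hk.le_sub
      have h2 := dist_le_diam_of_mem h.isBounded hy hx
      rw [Real.dist_eq] at h2
      have h3 := (le_abs_self _).trans h2
      simp only [hδdef, pow_zero, div_one] at h1
      linarith
    | succ l =>
      refine ⟨l, ?_, ?_, hk.le_sub, hgap _ (hδ0 l) x hx y hy (hmin l (by omega))⟩
      · intro j hj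
        have := gapChain_iff_of_not_hasGap (hδs j) hx hxy.le (hmin (j + 1) (by omega))
        simp only [this]
      · have h1 : GapChain E (δ l) (δ (l + 1))
            (Nat.findGreatest (fun m => GapChain E (δ l) (δ (l + 1)) m x) M) x :=
          Nat.findGreatest_spec (P := fun m => GapChain E (δ l) (δ (l + 1)) m x)
            (Nat.zero_le M) trivial
        have h2 : GapChain E (δ l) (δ (l + 1))
            (Nat.findGreatest (fun m => GapChain E (δ l) (δ (l + 1)) m x) M + 1) y :=
          ⟨x, hx, hmin l (by omega), hk, h1⟩
        exact Nat.le_findGreatest (hbound y hy l _ h2).le h2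

/-! ### Trees of points in a regular set -/

/-- A regular set of dimension `t` contains an image of the space of sequences with entries below
`M`, where `M` may be of the order `q ^ t`, with the same relation between order, distance and the
first place of disagreement as in `IsAhlforsRegularSet.exists_coding`. -/
theorem IsAhlforsRegularSet.exists_tree {t C : ℝ} {F : Set ℝ} (h : IsAhlforsRegularSet t C F)
    {q : ℝ} (hq : 4 ≤ q) {M : ℕ} (hM : (M : ℝ) ≤ (C ^ 2)⁻¹ * (q / 4) ^ t) :
    ∃ ψ : (ℕ → ℕ) → ℝ, (∀ a, (∀ k, a k < M) → ψ a ∈ F) ∧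
      ∀ a b, (∀ k, a k < M) → (∀ k, b k < M) → ∀ l, (∀ j < l, a j = b j) → a l < b l →
        diam F / q ^ (l + 1) ≤ ψ b - ψ a ∧ ψ b - ψ a ≤ 3 * (diam F / q ^ l) := by
  have hd := h.diam_pos
  have hq0 : 0 < q := by linarith
  set r : ℕ → ℝ := fun k => diam F / q ^ k with hrdef
  have hr0 : ∀ k, 0 < r k := fun k => by simp only [hrdef]; positivity
  have hrq : ∀ k, r (k + 1) = r k / q := fun k => by
    simp only [hrdef, pow_succ]
    field_simp
  have hrd : ∀ k, r k ≤ diam F := fun k =>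
    div_le_self hd.le (one_le_pow₀ (by linarith))
  have hr4 : ∀ k, r (k + 1) ≤ r k / 4 := fun k => by
    rw [hrq]
    exact div_le_div_of_nonneg_left (hr0 k).le (by norm_num) hq
  have hstep : ∀ (k : ℕ) (x : ℝ), ∃ y : ℕ → ℝ, x ∈ F →
      (∀ i < M, y i ∈ F ∧ |y i - x| ≤ r k) ∧ ∀ i j, i < j → j < M → 4 * r (k + 1) ≤ y j - y i := by
    intro k x
    by_cases hx : x ∈ F
    · obtain ⟨y, hy⟩ := h.exists_separated hq hM hx (hr0 k) (hrd k)
      rw [← hrq] at hy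
      exact ⟨y, fun _ => hy⟩
    · exact ⟨fun _ => 0, fun hx' => absurd hx' hx⟩
  choose child hchild using hstep
  obtain ⟨x₀, hx₀⟩ := h.nontrivial.nonempty
  let node : (ℕ → ℕ) → ℕ → ℝ := fun a k => Nat.rec x₀ (fun k x => child k x (a k)) k
  have hnode : ∀ a k, node a (k + 1) = child k (node a k) (a k) := fun a k => rfl
  have hmem : ∀ a, (∀ k, a k < M) → ∀ k, node a k ∈ F := by
    intro a ha k
    induction k with
    | zero => exact hx₀
    | succ k ih =>
      rw [hnode]
      exact ((hchild k _ ih).1 _ (ha k)).1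
  have hdist : ∀ a, (∀ k, a k < M) → ∀ k, |node a (k + 1) - node a k| ≤ r k := by
    intro a ha k
    rw [hnode]
    exact ((hchild k _ (hmem a ha k)).1 _ (ha k)).2
  have hcongr : ∀ a b l, (∀ j < l, a j = b j) → node a l = node b l := by
    intro a b l
    induction l with
    | zero => exact fun _ => rfl
    | succ l ih =>
      intro hab
      rw [hnode, hnode, ih fun j hj => hab j (by omega), hab l (by omega)]
  have hfar : ∀ a, (∀ k, a k < M) → ∀ k m,
      |node a (k + m) - node a k| ≤ 4 / 3 * r k - 4 / 3 * r (k + m) := by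
    intro a ha k m
    induction m with
    | zero => simp
    | succ m ih =>
      have h1 := hdist a ha (k + m)
      have h2 := hr4 (k + m)
      have h3 := abs_sub_le (node a (k + m + 1)) (node a (k + m)) (node a k)
      rw [← add_assoc]
      linarith
  have hlim : ∀ a, ∃ p, (∀ k, a k < M) → p ∈ F ∧ ∀ k, |p - node a k| ≤ 4 / 3 * r k := by
    intro a
    by_cases ha : ∀ k, a k < M
    · have hrlim : Tendsto (fun k => 4 / 3 * r k) atTop (𝓝 0) := by
        have h1 : Tendsto (fun k : ℕ => (q⁻¹) ^ k) atTop (𝓝 0) :=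
          tendsto_pow_atTop_nhds_zero_of_lt_one (by positivity)
            (inv_lt_one_of_one_lt₀ (by linarith))
        have h2 := h1.const_mul (4 / 3 * diam F)
        rw [mul_zero] at h2
        refine h2.congr fun k => ?_
        simp only [hrdef, inv_pow]
        ring
      have hcau : CauchySeq (node a) := by
        refine cauchySeq_of_le_tendsto_0' (fun k => 4 / 3 * r k) (fun k n hkn => ?_) hrlim
        obtain ⟨m, rfl⟩ := Nat.exists_eq_add_of_le hkn
        rw [dist_comm, Real.dist_eq]
        linarith [hfar a ha k m, hr0 (k + m)]
      obtain ⟨p, hp⟩ := cauchySeq_tendsto_of_complete hcau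
      refine ⟨p, fun _ => ⟨h.isClosed.mem_of_tendsto hp (Eventually.of_forall (hmem a ha)), ?_⟩⟩
      intro k
      refine le_of_tendsto ((hp.sub_const (node a k)).abs) ?_
      filter_upwards [eventually_ge_atTop k] with n hkn
      obtain ⟨m, rfl⟩ := Nat.exists_eq_add_of_le hkn
      linarith [hfar a ha k m, hr0 (k + m)]
    · exact ⟨0, fun ha' => absurd ha' ha⟩
  choose ψ hψ using hlim
  refine ⟨ψ, fun a ha => (hψ a ha).1, fun a b ha hb l hab hl => ?_⟩
  have h1 := hcongr a b l hab
  have h2 := (hchild l _ (hmem a ha l)).2 _ _ hl (hb l)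
  rw [← hnode, h1, ← hnode] at h2
  have a1 := abs_le.1 ((hψ a ha).2 (l + 1))
  have b1 := abs_le.1 ((hψ b hb).2 (l + 1))
  have a0 := abs_le.1 ((hψ a ha).2 l)
  have b0 := abs_le.1 ((hψ b hb).2 l)
  rw [h1] at a0
  have p0 := hr0 l
  have p1 := hr0 (l + 1)
  change r (l + 1) ≤ _ ∧ _ ≤ 3 * r l
  constructor <;> linarith

/-! ### The embedding -/

/-- The composition of the coding of `E` with the tree of points in `F`, for a common ratio `q` and
a common branching number `M`. -/
theorem IsAhlforsRegularSet.exists_strictMono_bilipschitz {s t CE CF q A : ℝ} {E F : Set ℝ}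
    (hE : IsAhlforsRegularSet s CE E) (hF : IsAhlforsRegularSet t CF F) (hA : 1 ≤ A)
    (hgap : ∀ δ > 0, ∀ x ∈ E, ∀ y ∈ E, ¬ HasGap E δ x y → y - x ≤ A * δ)
    (hq : 4 ≤ q) {M : ℕ} (hME : 2 * CE ^ 2 * 4 ^ s * (A * q) ^ s ≤ M)
    (hMF : (M : ℝ) ≤ (CF ^ 2)⁻¹ * (q / 4) ^ t) {L : ℝ≥0}
    (hL₁ : 3 * q * diam F ≤ L * (2 * diam E)) (hL₂ : 2 * A * q * diam E ≤ L * diam F) :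
    ∃ φ : E → F, StrictMono φ ∧ LipschitzWith L φ ∧ AntilipschitzWith L φ := by
  obtain ⟨n, hnM, hn⟩ := hE.exists_coding hA hgap hq hME
  obtain ⟨ψ, hψF, hψ⟩ := hF.exists_tree hq hMF
  have hq0 : 0 < q := by linarith
  have hdE := hE.diam_pos
  have hdF := hF.diam_pos
  let φ : E → F := fun x => ⟨ψ (n x), hψF _ (hnM x x.2)⟩
  have key : ∀ x y : E, x < y → (φ x : ℝ) < φ y ∧ (φ y : ℝ) - φ x ≤ L * (y - x : ℝ) ∧
      (y - x : ℝ) ≤ L * ((φ y : ℝ) - φ x) := by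
    intro x y hxy
    obtain ⟨l, hl1, hl2, hlo, hhi⟩ := hn x x.2 y y.2 hxy
    obtain ⟨hlo', hhi'⟩ := hψ _ _ (hnM x x.2) (hnM y y.2) l hl1 hl2
    change _ ≤ (φ y : ℝ) - φ x at hlo'
    change (φ y : ℝ) - φ x ≤ _ at hhi'
    have hpos : 0 < diam F / q ^ (l + 1) := by positivity
    refine ⟨by linarith, ?_, ?_⟩
    · calc (φ y : ℝ) - φ x ≤ 3 * (diam F / q ^ l) := hhi'
        _ = 3 * q * diam F / q ^ (l + 1) := by rw [pow_succ]; field_simp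
        _ ≤ L * (2 * diam E) / q ^ (l + 1) := by gcongr
        _ = L * (2 * diam E / q ^ (l + 1)) := by ring
        _ ≤ L * (y - x : ℝ) := by gcongr
    · calc (y - x : ℝ) ≤ A * (2 * diam E / q ^ l) := hhi
        _ = 2 * A * q * diam E / q ^ (l + 1) := by rw [pow_succ]; field_simp
        _ ≤ L * diam F / q ^ (l + 1) := by gcongr
        _ = L * (diam F / q ^ (l + 1)) := by ring
        _ ≤ L * ((φ y : ℝ) - φ x) := by gcongr
  have hdist : ∀ x y : E, dist (φ x) (φ y) ≤ L * dist x y ∧ dist x y ≤ L * dist (φ x) (φ y) := by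
    intro x y
    rcases lt_trichotomy x y with hxy | rfl | hxy
    · obtain ⟨h1, h2, h3⟩ := key x y hxy
      have hxy' : (x : ℝ) < y := hxy
      rw [dist_comm x, dist_comm (φ x), Subtype.dist_eq, Subtype.dist_eq, Real.dist_eq,
        Real.dist_eq, abs_of_pos (sub_pos.2 h1), abs_of_pos (sub_pos.2 hxy')]
      exact ⟨h2, h3⟩
    · simp
    · obtain ⟨h1, h2, h3⟩ := key y x hxy
      have hxy' : (y : ℝ) < x := hxy
      rw [Subtype.dist_eq, Subtype.dist_eq, Real.dist_eq,
        Real.dist_eq, abs_of_pos (sub_pos.2 h1), abs_of_pos (sub_pos.2 hxy')]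
      exact ⟨h2, h3⟩
  exact ⟨φ, fun x y hxy => (key x y hxy).1, LipschitzWith.of_dist_le_mul fun x y => (hdist x y).1,
    AntilipschitzWith.of_le_mul_dist fun x y => (hdist x y).2⟩

theorem theorem4p5 (s t : ℝ) (hst : s < t) (dE dF CE CF : ℝ) :
    ∃ L : ℝ≥0, ∀ E F : Set ℝ,
      IsAhlforsRegularSet s CE E → Metric.diam E = dE →
      IsAhlforsRegularSet t CF F → Metric.diam F = dF →
      (IsStandardCantor E ∨ IsStandardCantor F) →
      ∃ φ : E → F, StrictMono φ ∧ LipschitzWith L φ ∧ AntilipschitzWith L φ := by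
  -- If no pair of sets has these parameters, any `L` will do; otherwise the parameters satisfy
  -- the inequalities that one such pair forces on them.
  by_cases hne : ∃ E F : Set ℝ, IsAhlforsRegularSet s CE E ∧ diam E = dE ∧
      IsAhlforsRegularSet t CF F ∧ diam F = dF
  swap
  · exact ⟨0, fun E F h1 h2 h3 h4 _ => absurd ⟨E, F, h1, h2, h3, h4⟩ hne⟩
  obtain ⟨E₀, F₀, hE₀, hdE₀, hF₀, hdF₀⟩ := hne
  have hs := hE₀.dim_pos
  have hs1 : s < 1 := hst.trans_le hF₀.dim_le_one
  have hCE := hE₀.const_pos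
  have hCF := hF₀.const_pos
  have hdE : 0 < dE := hdE₀ ▸ hE₀.diam_pos
  have hdF : 0 < dF := hdF₀ ▸ hF₀.diam_pos
  set A : ℝ := max 2 ((4 * (2 * CE ^ 2 * 4 ^ s)) ^ (1 / (1 - s))) with hAdef
  have hA : 1 ≤ A := le_trans (by norm_num) (le_max_left _ _)
  -- The ratio `q` is so large that `q ^ t` beats `q ^ s` together with all constants: the branching
  -- of `E` at ratio `q` is then no larger than what `F` can accommodate.
  obtain ⟨q, hq, hle⟩ := exists_le_mul_rpow hs.le hst (2 * CE ^ 2 * 4 ^ s * A ^ s) 1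
    (c := (CF ^ 2)⁻¹ * (1 / 4) ^ t) zero_le_one (by positivity)
  have hq0 : 0 < q := by linarith
  have hMF : (⌈2 * CE ^ 2 * 4 ^ s * (A * q) ^ s⌉₊ : ℝ) ≤ (CF ^ 2)⁻¹ * (q / 4) ^ t := by
    have e1 : (q / 4) ^ t = (1 / 4) ^ t * q ^ t := by
      rw [← Real.mul_rpow (by positivity) hq0.le]
      congr 1
      ring
    have e2 : (A * q) ^ s = A ^ s * q ^ s := Real.mul_rpow (by linarith) hq0.le
    rw [e1, ← mul_assoc]
    refine (Nat.ceil_lt_add_one (by positivity)).le.trans ?_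
    rw [e2, ← mul_assoc]
    exact hle
  refine ⟨Real.toNNReal (max (3 * q * dF / (2 * dE)) (2 * A * q * dE / dF)), ?_⟩
  rintro E F hE rfl hF rfl -
  refine hE.exists_strictMono_bilipschitz hF hA
    (fun δ hδ x hx y hy hg => hE.sub_le_of_not_hasGap hs1 hδ hx hy hg) hq
    (Nat.le_ceil _) hMF ?_ ?_
  · rw [← div_le_iff₀ (by positivity)]
    exact (le_max_left _ _).trans (Real.le_coe_toNNReal _)
  · rw [← div_le_iff₀ hdF]
    exact (le_max_right _ _).trans (Real.le_coe_toNNReal _)
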